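/- **Setting.** Let $A=\mathbb C^g/\Lambda$ be a principally polarised abelian variety of dimension $g$, with polarisation $H$ (linear in the first and antilinear in the second variable) and a basis $\lambda_1,\dots,\lambda_{2g}$ of $\Lambda$ that is symplectic for $\mathrm{Im}\,H$, with $\mathrm{Im}\,H(\lambda_i,\lambda_{g+j})=\delta_{ij}$. Identify the dual abelian variety $A^*=\mathrm{Hom}_{\overline{\mathbb C}}(\mathbb C^g,\mathbb C)/\Lambda^*$ with $\mathbb C^g/\Lambda$ through $z\mapsto H(z,\cdot)$. Let $\theta$ be a theta function belonging to $H$ with divisor $D\not\ni 0$, normalised by $\theta(0)=1$, $d\log\theta(0)=0$; write $d\log\theta=\sum_j h_j\,dz_j$, $\omega_j=dz_j$, $\eta_j=dh_j$, and $$F_q(z)=\frac{\theta(z+q)}{\theta(z)\theta(q)}\,e^{-\sum_j h_j(q)z_j}.$$ Let $M=[u:\mathbb Z^n\to G]$ be a 1-motive over $\mathbb C$ (or the extension of scalars to $\mathbb C$ of a 1-motive over a subfield), where $G$ is the extension of $A$ by $\mathbb G_m^s$ parameterised by points $Q_k=\exp_{A^*}(q_k)$, $k=1,\dots,s$, of $A^*$,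 with exponential map $\exp_G(z,t)=(\exp_A(z),(e^{t_k}F_{q_k}(z))_k)$ in the rational coordinates $A\times\mathbb G_m^s$, and where $u(x_i)=R_i\in G$ lies above $P_i\in A$ ($i=1,\dots,n$). Let $M^*=[u^*:\mathbb Z^s\to G^*]$ be its Cartier dual: $G^*$ is the extension of $A^*$ by $\mathbb G_m^n$ parameterised by $P_1,\dots,P_n$, and $u^*(y_k)=R_k^*$ lies above $Q_k$ and is given by the same points $\psi(x_i,y_k)\in\mathcal P_{P_i,Q_k}$ of the Poincaré biextension $\mathcal P$ of $(A,A^*)$ by $\mathbb G_m$ as the points $R_i$. **Bases.** Let $\xi^G_{Q_k}=-\tilde\xi_{Q_k}+\pi^*\xi_{Q_k}$ be the invariant form on $G$ where $\tilde\xi_{Q_k}=dZ_k/Z_k$ for the $k$-th rational coordinate $Z_k:G\cong A\times \mathbb G_m^s\to\mathbb G_m$, $\pi:G\to A$ is the projection, and $\xi_{Q_k}$ has pull-back $d\log F_{q_k}$ to $\mathbb C^g$. Let $[O,R_i]$ be a path in $G$ from the origin to $R_i$, $\gamma_a$ a loop in $G$ lifting the loop $\lambda_a$ of $A$ ($a=1,\dots,2g$),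 $\delta_k$ a loop in $\mathbb G_m^s$ with $\int_{\delta_k}\xi^G_{Q_l}=2i\pi\,\delta_{kl}$, and $df_i$ an exact class with $f_i(R_j)-f_i(O)=\delta_{ij}$. Fix similar choices $[O,R_k^*],\gamma_a,\delta_i^*,\xi^{G^*}_{P_i},df_k^*$ for $M^*$. All paths are continuously differentiable and avoid the poles of the forms, where $D$ is chosen so that this is possible (in particular it avoids the $P_i$, $Q_k$ and $P_i+Q_k$). Take as ordered bases - of $\mathrm T_{\mathrm H}(M)$: $\ [O,R_1],\dots,[O,R_n],\gamma_1,\dots,\gamma_{2g},\delta_1,\dots,\delta_s$; - of $\mathrm T_{\mathrm{dR}}(M)$: $\ \xi^G_{Q_1},\dots,\xi^G_{Q_s},\pi^*\omega_1,\dots,\pi^*\omega_g,\pi^*\eta_1,\dots,\pi^*\eta_g,df_1,\dots,df_n$; - of $\mathrm T_{\mathrm H}(M^*)$: $\ \delta_1^*,\dots,\delta_n^*,-\gamma_{g+1},\dots,-\gamma_{2g},\gamma_1,\dots,\gamma_g,-[O,R_1^*],\dots,-[O,R_s^*]$; - of $\mathrm T_{\mathrm{dR}}(M^*)$: $\ -df_1^*,\dots,-df_s^*,-\pi^*\eta_1,\dots,-\pi^*\eta_g,\pi^*\omega_1,\dots,\pi^*\omega_g,\xi^{G^*}_{P_1},\dots,\xi^{G^*}_{P_n}$;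 where the paths and loops are chosen so that the bases of $\mathrm T_{\mathrm H}(M)$ and $\mathrm T_{\mathrm H}(M^*)$ are dual to each other for the Weil pairing $\mathrm T_{\mathrm H}(M)\otimes \mathrm T_{\mathrm H}(M^*)\to 2i\pi\mathbb Z$ (the pairing of the $a$-th and the $b$-th element is $2i\pi\,\delta_{ab}$). Here the Weil pairing of an element of $\mathrm T_{\mathrm H}(M)$ above $x\in\mathbb Z^n$ with an element of $\mathrm T_{\mathrm H}(M^*)$ above $y\in\mathbb Z^s$ is the difference of the two logarithms of $\psi(x,y)\in\mathcal P$ that they define; on $A$ it is $(\lambda,\mu)\mapsto 2i\pi\,\mathrm{Im}\,H(\mu,\lambda)$. Let $\Pi_M$ and $\Pi_{M^*}$ be the $(n+2g+s)\times(n+2g+s)$ matrices of the periods of $M$ and $M^*$ with respect to these bases (rows: paths, columns: forms). **Statement.** One has $$\Pi_{M^*}=\bigl(2i\pi\,\Pi_M^{-1}\bigr)^t .$$ In particular $\Pi_M$ is invertible, $\det\Pi_M=\pm(2i\pi)^{g+s}$ and $\det\Pi_{M^*}=\pm(2i\pi)^{n+g}$. -/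

import Mathlib

noncomputable section

open Complex

namespace OneMot

/-! ### Principally polarised abelian varieties and their theta functions -/

/-- The coordinate space `ℂ^g = Lie A`. -/
abbrev LieA (g : ℕ) : Type := Fin g → ℂ

/-- The matrix `J` with blocks `0, Id, -Id, 0`. -/
def stdJ (g : ℕ) : Matrix (Fin g ⊕ Fin g) (Fin g ⊕ Fin g) ℝ :=
  Matrix.fromBlocks 0 1 (-1) 0

/-- A `g`-dimensional principally polarised complex abelian variety `A = ℂ^g/Λ`, together with an
ordered basis `λ_1, …, λ_{2g}` of `Λ`. The polarisation `H` is a positive definite Hermitian form,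
linear in its first and antilinear in its second argument. The basis is symplectic for the
alternating form `Im H`; in particular `Im H` is integral and unimodular on `Λ`, that is, the
polarisation is principal. -/
structure PPAV (g : ℕ) where
  H : LieA g →ₗ[ℂ] LieA g →ₗ⋆[ℂ] ℂ
  hermitian : ∀ z w, H w z = (starRingEnd ℂ) (H z w)
  pos : ∀ z, z ≠ 0 → 0 < (H z z).re
  lam : Module.Basis (Fin g ⊕ Fin g) ℝ (LieA g)
  symplectic : ∀ a b, (H (lam a) (lam b)).im = stdJ g a b

namespace PPAV

variable {g : ℕ} (A : PPAV g)

/-- The lattice `Λ = H_1(A(ℂ), ℤ)`. -/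
def lattice : AddSubgroup (LieA g) := AddSubgroup.closure (Set.range A.lam)

/-- The complex torus `A(ℂ) = ℂ^g/Λ`. By `dual_lattice` below, the map `z ↦ H(z, ·)` induces an
isomorphism of `ℂ^g/Λ` onto the dual abelian variety `A^*(ℂ) = Hom_antilinear(ℂ^g, ℂ)/Λ^*`, so that
this group is also used for `A^*(ℂ)`: the class of `q` stands for the class of `H(q, ·)`. -/
abbrev Torus : Type := LieA g ⧸ A.lattice

/-- The dual lattice `Λ^*`: antilinear forms `f` with `Im f(Λ) ⊆ ℤ`. -/
def dualLattice : AddSubgroup (LieA g →ₗ⋆[ℂ] ℂ) where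
  carrier := {f | ∀ l ∈ A.lattice, ∃ m : ℤ, (f l).im = m}
  zero_mem' := fun _ _ => ⟨0, by simp⟩
  add_mem' := by
    intro f f' hf hf' l hl
    obtain ⟨m, hm⟩ := hf l hl
    obtain ⟨m', hm'⟩ := hf' l hl
    exact ⟨m + m', by simp [hm, hm']⟩
  neg_mem' := by
    intro f hf l hl
    obtain ⟨m, hm⟩ := hf l hl
    exact ⟨-m, by simp [hm]⟩

theorem im_H_lam (z : LieA g) (b : Fin g ⊕ Fin g) :
    (A.H z (A.lam b)).im = ∑ a, A.lam.repr z a * stdJ g a b := by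
  conv_lhs => rw [← A.lam.sum_repr z]
  simp only [map_sum, LinearMap.sum_apply, Complex.im_sum]
  refine Finset.sum_congr rfl fun a _ => ?_
  have h : A.lam.repr z a • A.lam a = ((A.lam.repr z a : ℝ) : ℂ) • A.lam a := by
    ext i; simp
  rw [h, map_smul, LinearMap.smul_apply, smul_eq_mul, Complex.im_ofReal_mul, A.symplectic]

theorem int_im_H {l m : LieA g} (hl : l ∈ A.lattice) (hm : m ∈ A.lattice) :
    ∃ k : ℤ, (A.H l m).im = k := by
  induction hl, hm using AddSubgroup.closure_induction₂ with
  | mem x y hx hy =>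
    obtain ⟨a, rfl⟩ := hx
    obtain ⟨b, rfl⟩ := hy
    rw [A.symplectic]
    rcases a with a | a <;> rcases b with b | b <;>
      simp only [stdJ, Matrix.fromBlocks_apply₁₁, Matrix.fromBlocks_apply₁₂,
        Matrix.fromBlocks_apply₂₁, Matrix.fromBlocks_apply₂₂, Matrix.zero_apply,
        Matrix.neg_apply, Matrix.one_apply]
    · exact ⟨0, by simp⟩
    · exact ⟨if a = b then 1 else 0, by split_ifs <;> simp⟩
    · exact ⟨if a = b then -1 else 0, by split_ifs <;> simp⟩
    · exact ⟨0, by simp⟩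
  | zero_left x _ => exact ⟨0, by simp⟩
  | zero_right x _ => exact ⟨0, by simp⟩
  | add_left x y z _ _ _ h h' =>
    obtain ⟨k, hk⟩ := h
    obtain ⟨k', hk'⟩ := h'
    exact ⟨k + k', by simp [hk, hk']⟩
  | add_right x y z _ _ _ h h' =>
    obtain ⟨k, hk⟩ := h
    obtain ⟨k', hk'⟩ := h'
    exact ⟨k + k', by simp [hk, hk']⟩
  | neg_left x y _ _ h =>
    obtain ⟨k, hk⟩ := h
    exact ⟨-k, by simp [hk]⟩
  | neg_right x y _ _ h =>
    obtain ⟨k, hk⟩ := h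
    exact ⟨-k, by simp [hk]⟩

/-- Since the polarisation is principal, `z ↦ H(z, ·)` identifies `Λ` with `Λ^*`. -/
theorem dual_lattice (z : LieA g) : A.H z ∈ A.dualLattice ↔ z ∈ A.lattice := by
  constructor
  · intro h
    have key : ∀ a, ∃ m : ℤ, A.lam.repr z a = m := by
      rintro (a | a)
      · obtain ⟨m, hm⟩ := h (A.lam (Sum.inr a)) (AddSubgroup.subset_closure ⟨_, rfl⟩)
        rw [im_H_lam] at hm
        exact ⟨m, by simpa [stdJ, Matrix.one_apply] using hm⟩
      · obtain ⟨m, hm⟩ := h (A.lam (Sum.inl a)) (AddSubgroup.subset_closure ⟨_, rfl⟩)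
        rw [im_H_lam] at hm
        refine ⟨-m, ?_⟩
        have : -A.lam.repr z (Sum.inr a) = m := by
          simpa [stdJ, Matrix.one_apply] using hm
        push_cast
        linarith
    rw [← A.lam.sum_repr z]
    refine AddSubgroup.sum_mem _ fun a _ => ?_
    obtain ⟨m, hm⟩ := key a
    rw [hm, Int.cast_smul_eq_zsmul]
    exact AddSubgroup.zsmul_mem _ (AddSubgroup.subset_closure (Set.mem_range_self a)) m
  · intro hz l hl
    exact A.int_im_H hz hl

end PPAV

/-- A theta function `θ` on `ℂ^g` belonging to the polarisation `H`, normalised by `θ(0) = 1` and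
`d log θ(0) = 0`. Its divisor is denoted by `D`. The constant `c` (a semi-character of `Λ`, up to
factors that do not depend on `z`) is arbitrary, so that `D` may be replaced by a translate. -/
structure Theta {g : ℕ} (A : PPAV g) where
  toFun : LieA g → ℂ
  holomorphic : AnalyticOnNhd ℂ toFun Set.univ
  quasi_periodic : ∀ l ∈ A.lattice, ∃ c : ℂ, ∀ z,
    toFun (z + l) = c * exp (Real.pi * A.H z l) * toFun z
  map_zero : toFun 0 = 1
  fderiv_zero : fderiv ℂ toFun 0 = 0

namespace Theta

variable {g : ℕ} {A : PPAV g} (θ : Theta A)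

instance : CoeFun (Theta A) (fun _ => LieA g → ℂ) := ⟨Theta.toFun⟩

/-- `h_j = ∂ log θ / ∂ z_j`, so that `d log θ = ∑ h_j dz_j`. -/
def h (j : Fin g) (z : LieA g) : ℂ := fderiv ℂ θ z (Pi.single j 1) / θ z

/-- The linear form `z ↦ ∑ h_j(q) z_j`. -/
def hDot (q z : LieA g) : ℂ := ∑ j, θ.h j q * z j

/-- `F_q(z) = θ(z+q) / (θ(z) θ(q)) · exp(-∑ h_j(q) z_j)`. For `θ(q) ≠ 0` this meromorphic function
of `z` only depends on `q` modulo `Λ`. -/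
def F (q z : LieA g) : ℂ := θ (z + q) / (θ z * θ q) * exp (-θ.hDot q z)

end Theta

/-! ### Extensions of an abelian variety by a torus -/

/-- `Lie G = Lie A × Lie 𝔾_m^s`, for `G` an extension of `A` by `𝔾_m^s`. -/
abbrev LieG (g s : ℕ) : Type := LieA g × (Fin s → ℂ)

section SemiAbelian

variable {g s : ℕ} {A : PPAV g} (θ : Theta A) (q : Fin s → LieA g)

/-- The pull-back to `Lie G` of the rational function `Z_k : G ≅ A × 𝔾_m^s → 𝔾_m` (projection to the
`k`-th factor of the torus). The exponential map of `G` is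
`exp_G(z, t) = (exp_A(z), (exp(t_k) F_{q_k}(z))_k)`. -/
def coordZ (k : Fin s) (l : LieG g s) : ℂ := exp (l.2 k) * θ.F (q k) l.1

/-- The kernel `H_1(G(ℂ), ℤ)` of `exp_G`: the translations of `Lie G` which do not change
`(exp_A(z), (exp(t_k) F_{q_k}(z))_k)`. -/
def kerExp : AddSubgroup (LieG g s) where
  carrier := {l | l.1 ∈ A.lattice ∧
    ∀ k z, exp (l.2 k) * θ.F (q k) (z + l.1) = θ.F (q k) z}
  zero_mem' := ⟨A.lattice.zero_mem, by simp⟩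
  add_mem' := by
    rintro l l' ⟨h, h2⟩ ⟨h', h2'⟩
    refine ⟨A.lattice.add_mem h h', fun k z => ?_⟩
    rw [← h2 k z, ← h2' k (z + l.1)]
    simp only [Prod.snd_add, Pi.add_apply, Prod.fst_add, exp_add, add_assoc]
    ring
  neg_mem' := by
    rintro l ⟨h, h2⟩
    refine ⟨A.lattice.neg_mem h, fun k z => ?_⟩
    have := h2 k (z + -l.1)
    simp only [neg_add_cancel_right] at this
    simp only [Prod.snd_neg, Pi.neg_apply, Prod.fst_neg]
    rw [← this, ← mul_assoc, ← exp_add]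
    simp

/-- The group `G(ℂ)` of the extension `G` of `A` by `𝔾_m^s` parameterised by the points
`Q_k = exp_{A^*}(q_k)` of `A^*`. -/
abbrev SemiAb : Type := LieG g s ⧸ kerExp θ q

/-- `exp_G : Lie G → G(ℂ)`. -/
def expG : LieG g s →+ SemiAb θ q := QuotientAddGroup.mk' _

/-- The projection `G → A`. -/
def projA : SemiAb θ q →+ A.Torus :=
  QuotientAddGroup.map (kerExp θ q) A.lattice (AddMonoidHom.fst _ _) fun _ h => h.1

end SemiAbelian

/-! ### 1-motives and Cartier duality -/

/-- A 1-motive `M = [u : ℤ^n → G]`, with `G` the extension of `A` by `𝔾_m^s` parameterised by points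
`Q_1, …, Q_s` of `A^*`, given through logarithms `q_k` of them (modulo `Λ` they may be changed
at will, without changing `G`). The divisor `D` of `θ` has to avoid the points `Q_k`,
otherwise `F_{q_k}` is not defined. -/
structure OneMotive {g : ℕ} {A : PPAV g} (θ : Theta A) (n s : ℕ) where
  q : Fin s → LieA g
  theta_q : ∀ k, θ (q k) ≠ 0
  u : (Fin n → ℤ) →+ SemiAb θ q

section Poincare

variable {g : ℕ} (A : PPAV g)

/-- `(z', q', w')` and `(z, q, w)` define the same point of the Poincaré biextension of
`(A, A^*)` by `𝔾_m`. In terms of the function `Θ_q(z) = θ(z+q)/(θ(z)θ(q))`, the rational coordinate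
`w Θ_q(z)` of the point `(z, q, w)` does not change. -/
def poincareRel (x x' : LieA g × LieA g × ℂˣ) : Prop :=
  ∃ l ∈ A.lattice, ∃ m ∈ A.lattice, x'.1 = x.1 + l ∧ x'.2.1 = x.2.1 + m ∧
    (x'.2.2 : ℂ) = x.2.2 * exp (-Real.pi * (A.H x.2.1 l + A.H x.1 m + A.H m l))

theorem exp_comm_H {l m : LieA g} (hl : l ∈ A.lattice) (hm : m ∈ A.lattice) :
    exp (Real.pi * A.H l m) = exp (Real.pi * A.H m l) := by
  obtain ⟨k, hk⟩ := A.int_im_H hl hm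
  rw [Complex.exp_eq_exp_iff_exists_int]
  refine ⟨k, ?_⟩
  rw [A.hermitian l m]
  apply Complex.ext
  · simp
  · simp [hk]
    ring

/-- The Poincaré biextension `𝒫` of `(A, A^*)` by `𝔾_m`: the quotient of `ℂ^g × ℂ^g × ℂ^*` by
`Λ × Λ`, acting through the factor of automorphy. -/
def poincareSetoid : Setoid (LieA g × LieA g × ℂˣ) where
  r := poincareRel A
  iseqv := by
    refine ⟨fun x => ⟨0, zero_mem _, 0, zero_mem _, by simp, by simp, by simp⟩, ?_, ?_⟩
    · rintro x x' ⟨l, hl, m, hm, h1, h2, h3⟩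
      refine ⟨-l, neg_mem hl, -m, neg_mem hm, by simp [h1], by simp [h2], ?_⟩
      have e := exp_comm_H A hl hm
      rw [h3, h1, h2, mul_assoc, ← exp_add]
      have : -Real.pi * (A.H x.2.1 l + A.H x.1 m + A.H m l) +
          -Real.pi * (A.H (x.2.1 + m) (-l) + A.H (x.1 + l) (-m) + A.H (-m) (-l))
          = Real.pi * A.H l m - Real.pi * A.H m l := by
        simp only [map_add, map_neg, LinearMap.add_apply, LinearMap.neg_apply]
        ring
      rw [this, exp_sub, e, div_self (exp_ne_zero _), mul_one]
    · rintro x x' x'' ⟨l, hl, m, hm, h1, h2, h3⟩ ⟨l', hl', m', hm', h1', h2', h3'⟩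
      refine ⟨l + l', add_mem hl hl', m + m', add_mem hm hm', by rw [h1', h1, add_assoc],
        by rw [h2', h2, add_assoc], ?_⟩
      have e := exp_comm_H A hl hm'
      rw [h3', h3, h1, h2, mul_assoc, ← exp_add]
      have : -Real.pi * (A.H x.2.1 l + A.H x.1 m + A.H m l) +
          -Real.pi * (A.H (x.2.1 + m) l' + A.H (x.1 + l) m' + A.H m' l')
          = -Real.pi * (A.H x.2.1 (l + l') + A.H x.1 (m + m') + A.H (m + m') (l + l'))
            + (Real.pi * A.H m' l - Real.pi * A.H l m') := by
        simp only [map_add, LinearMap.add_apply]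
        ring
      rw [this, exp_add, exp_sub, e, div_self (exp_ne_zero _), mul_one]

/-- The set of complex points of the Poincaré biextension. -/
def Poincare : Type := Quotient (poincareSetoid A)

/-- The point of `𝒫` defined by `(z, q, w)`. -/
def Poincare.mk (z q : LieA g) (w : ℂˣ) : Poincare A :=
  Quotient.mk (poincareSetoid A) (z, q, w)

end Poincare

namespace OneMotive

variable {g n s : ℕ} {A : PPAV g} {θ : Theta A} (M : OneMotive θ n s)

/-- The exponential map of the extension `G`. -/
abbrev exp : LieG g s →+ SemiAb θ M.q := expG θ M.q

/-- The points `R_i = u(x_i)` of `G`, with `x_1, …, x_n` the standard basis of `ℤ^n`. -/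
def R (i : Fin n) : SemiAb θ M.q := M.u (Pi.single i 1)

/-- The points `P_i = v(x_i)` of `A`. -/
def P (i : Fin n) : A.Torus := projA θ M.q (M.R i)

/-- The points `Q_k = v^*(y_k)` of `A^*`, which parameterise the extension `G`. -/
def Q (k : Fin s) : A.Torus := (M.q k : A.Torus)

/-- The isomorphism `G_{Q_k} ≅ 𝒫|_{A × {Q_k}}`, composed with the push-forward `G → G_{Q_k}` and with
the exponential map. It is the identity in rational coordinates, that is
`exp(t_k) F_{q_k}(z) = w Θ_{q_k}(z)`. -/
def toPoincare (k : Fin s) (l : LieG g s) : Poincare A :=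
  Poincare.mk A l.1 (M.q k)
    (Units.mk0 (Complex.exp (l.2 k - θ.hDot (M.q k) l.1)) (Complex.exp_ne_zero _))

/-- The same for an extension `G^*` of `A^*` by `𝔾_m^s` parameterised by points of `A`: the isomorphism
`G^*_{P_i} ≅ 𝒫|_{{P_i} × A^*}`. -/
def toPoincare' (i : Fin s) (l : LieG g s) : Poincare A :=
  Poincare.mk A (M.q i) l.1
    (Units.mk0 (Complex.exp (l.2 i - θ.hDot (M.q i) l.1)) (Complex.exp_ne_zero _))

/-- `M' = [u^* : ℤ^s → G^*]` is the Cartier dual of `M = [u : ℤ^n → G]`: the extension `G^*` of `A^*` by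
`𝔾_m^n` is parameterised by the points `P_i`, the points `R_k^* = u^*(y_k)` lie above the points
`Q_k`, and both 1-motives have the same trivialisation `ψ`, that is, the point of `𝒫_{P_i, Q_k}`
given by `R_i` (namely `ψ(x_i, y_k)`) is the point given by `R_k^*`. -/
def IsCartierDual (M : OneMotive θ n s) (M' : OneMotive θ s n) : Prop :=
  (∀ i, M.P i = M'.Q i) ∧ (∀ k, M'.P k = M.Q k) ∧
  ∀ i k, ∀ r : LieG g s, ∀ r' : LieG g n, M.exp r = M.R i → M'.exp r' = M'.R k →
    M.toPoincare k r = M'.toPoincare' i r'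

/-! ### Chains, differential forms and periods -/

/-- A path in `Lie G` together with `x ∈ ℤ^n`, such that the image of the path in `G` goes from a
point `O'` to `O' + u(x)`. Its class in `T_H(M)` is `class'`. -/
structure Chain where
  src : LieG g s
  tgt : LieG g s
  path : Path src tgt
  x : Fin n → ℤ
  boundary : M.exp (tgt - src) = M.u x

/-- The Hodge realisation `T_H(M)`: pairs `(l, x)` with `exp_G(l) = u(x)`. -/
def TH : AddSubgroup (LieG g s × (Fin n → ℤ)) :=
  ((M.exp.comp (AddMonoidHom.fst _ _)) - (M.u.comp (AddMonoidHom.snd _ _))).ker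

variable {M} in
/-- The opposite of a chain. -/
def Chain.neg (c : M.Chain) : M.Chain where
  src := c.tgt
  tgt := c.src
  path := c.path.symm
  x := -c.x
  boundary := by rw [map_neg, ← c.boundary, ← map_neg, neg_sub]

variable {M} in
/-- The class of a chain in the Hodge realisation. -/
def Chain.class' (c : M.Chain) : M.TH :=
  ⟨(c.tgt - c.src, c.x), by simp [TH, AddMonoidHom.mem_ker, c.boundary]⟩

variable {M} in
/-- The path is continuously differentiable and avoids the zeros and the poles of the functions
`F_{q_k}` and `θ`, that is, the poles of the differential forms below. -/
structure Chain.Regular (c : M.Chain) : Prop where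
  contDiffOn : ContDiffOn ℝ 1 c.path.extend (Set.Icc 0 1)
  theta_ne : ∀ τ, θ (c.path τ).1 ≠ 0
  theta_add_ne : ∀ τ k, θ ((c.path τ).1 + M.q k) ≠ 0

/-- A class in `T_dR(M)`, represented by a (meromorphic) differential 1-form on `G`, pulled back to
`Lie G`, and a linear form `ℤ^n → ℂ`. -/
structure Form (_M : OneMotive θ n s) where
  form : LieG g s → LieG g s →L[ℂ] ℂ
  lin : Fin n → ℂ

variable {M} in
/-- The opposite of a form. -/
def Form.neg (w : M.Form) : M.Form where
  form := fun l => -w.form l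
  lin := -w.lin

variable {M} in
/-- The period of a form along a chain. -/
def period (c : M.Chain) (w : M.Form) : ℂ :=
  curveIntegral w.form c.path + ∑ i, w.lin i * c.x i

/-- `π^* ω_j`, where `ω_j = dz_j`. -/
def omega (j : Fin g) : M.Form where
  form := fun _ => (ContinuousLinearMap.proj j).comp (ContinuousLinearMap.fst ℂ _ _)
  lin := 0

/-- `π^* η_j`, where the differential of the second kind `η_j` has pull-back `dh_j` to `Lie A`. -/
def eta (j : Fin g) : M.Form where
  form := fun l => (fderiv ℂ (θ.h j) l.1).comp (ContinuousLinearMap.fst ℂ _ _)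
  lin := 0

/-- `ξ_{Q_k}^G = - dZ_k / Z_k + π^* ξ_{Q_k}`, where the differential of the third kind `ξ_{Q_k}` has
pull-back `d log F_{q_k}` to `Lie A`. -/
def xi (k : Fin s) : M.Form where
  form := fun l =>
    -((coordZ θ M.q k l)⁻¹ • fderiv ℂ (coordZ θ M.q k) l) +
      (θ.F (M.q k) l.1)⁻¹ • (fderiv ℂ (θ.F (M.q k)) l.1).comp (ContinuousLinearMap.fst ℂ _ _)
  lin := 0

/-- The class of an exact form `df` on `G`, to which a linear form on `ℤ^n` may be added. In the
realisation, `(df, a)` only depends on the values `f(R_i) - f(O) + a_i`. -/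
def exact (f : LieG g s → ℂ) (a : Fin n → ℂ) : M.Form where
  form := fun l => fderiv ℂ f l
  lin := a

/-- The geometric choices behind the bases of `T_H(M)` and `T_dR(M)`:
* `pathR i` is a path `[O, R_i]`, lifted to a path from `0` to a logarithm `r_i` of `R_i`;
* `loopγ a` is a loop `γ_a` in `G` which lifts the loop `λ_a` of `A`;
* `loopδ k` is a loop `δ_k` in the torus `𝔾_m^s`, with `∫_{δ_k} ξ_{Q_l}^G = 2iπ` if `k = l` and `0`
  otherwise;
* `(f i, a i)` represents an exact class with value `1` at `R_j` if `i = j` and `0` otherwise. Here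
  `f i` is a function on `G`, without poles on the paths above. A function with the required values
  need not exist if the points `O, R_1, …, R_n` are not distinct, hence the constants `a i`; if it
  exists, one may take `a i = 0`. One may always take `f i = 0`. -/
structure Choices where
  pathR : Fin n → M.Chain
  loopγ : Fin g ⊕ Fin g → M.Chain
  loopδ : Fin s → M.Chain
  regularR : ∀ i, (pathR i).Regular
  regularγ : ∀ a, (loopγ a).Regular
  regularδ : ∀ k, (loopδ k).Regular
  srcR : ∀ i, (pathR i).src = 0
  xR : ∀ i, (pathR i).x = Pi.single i 1
  xγ : ∀ a, (loopγ a).x = 0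
  liftγ : ∀ a, (loopγ a).tgt.1 - (loopγ a).src.1 = A.lam a
  xδ : ∀ k, (loopδ k).x = 0
  torusδ : ∀ k τ, ((loopδ k).path τ).1 = 0
  normδ : ∀ k l, curveIntegral (M.xi l).form (loopδ k).path =
    if k = l then 2 * Real.pi * Complex.I else 0
  f : Fin n → LieG g s → ℂ
  a : Fin n → Fin n → ℂ
  periodic : ∀ i, ∀ κ ∈ kerExp θ M.q, ∀ l, f i (l + κ) = f i l
  analyticR : ∀ i j τ, AnalyticAt ℂ (f i) ((pathR j).path τ)
  analyticγ : ∀ i b τ, AnalyticAt ℂ (f i) ((loopγ b).path τ)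
  analyticδ : ∀ i k τ, AnalyticAt ℂ (f i) ((loopδ k).path τ)
  value : ∀ i j, f i (pathR j).tgt - f i 0 + a i j = if i = j then 1 else 0

/-- The index set of `T_H(M)` in its order (`n`, then `2g`, then `s` elements). -/
abbrev Idx (n g s : ℕ) : Type := Fin n ⊕ ((Fin g ⊕ Fin g) ⊕ Fin s)

variable {M} in
/-- The ordered basis `[O,R_1], …, [O,R_n], γ_1, …, γ_{2g}, δ_1, …, δ_s` of `T_H(M)`. -/
def Choices.basisH (B : M.Choices) : Idx n g s → M.Chain
  | .inl i => B.pathR i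
  | .inr (.inl a) => B.loopγ a
  | .inr (.inr k) => B.loopδ k

variable {M} in
/-- The ordered basis `ξ_{Q_1}^G, …, ξ_{Q_s}^G, π^*ω_1, …, π^*ω_g, π^*η_1, …, π^*η_g, df_1, …, df_n`
of `T_dR(M)`. -/
def Choices.basisDR (B : M.Choices) : Idx s g n → M.Form
  | .inl k => M.xi k
  | .inr (.inl (.inl j)) => M.omega j
  | .inr (.inl (.inr j)) => M.eta j
  | .inr (.inr i) => M.exact (B.f i) (B.a i)

variable {M' : OneMotive θ s n}

/-- The ordered basis
`δ_1^*, …, δ_n^*, -γ_{g+1}, …, -γ_{2g}, γ_1, …, γ_g, -[O,R_1^*], …, -[O,R_s^*]` of `T_H(M^*)`. -/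
def Choices.dualBasisH (B : M'.Choices) : Idx n g s → M'.Chain
  | .inl i => B.loopδ i
  | .inr (.inl (.inl j)) => (B.loopγ (.inr j)).neg
  | .inr (.inl (.inr j)) => B.loopγ (.inl j)
  | .inr (.inr k) => (B.pathR k).neg

/-- The ordered basis
`-df_1^*, …, -df_s^*, -π^*η_1, …, -π^*η_g, π^*ω_1, …, π^*ω_g, ξ_{P_1}^{G^*}, …, ξ_{P_n}^{G^*}` of
`T_dR(M^*)`. -/
def Choices.dualBasisDR (B : M'.Choices) : Idx s g n → M'.Form
  | .inl k => (M'.exact (B.f k) (B.a k)).neg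
  | .inr (.inl (.inl j)) => (M'.eta j).neg
  | .inr (.inl (.inr j)) => M'.omega j
  | .inr (.inr i) => M'.xi i

/-! ### The pairing between the Hodge realisations of `M` and `M^*` -/

/-- The point `(l, x)` of `T_H(M)` and `y ∈ ℤ^s` define a point of the universal cover
`ℂ^g × ℂ^g × ℂ` of the Poincaré biextension: on the fibre over `(z, ∑ y_k q_k)`, where `l = (z, t)`,
it has the coordinate `∑ y_k (t_k - ∑ h_j(q_k) z_j)`. This is its coordinate after translation from
`(z, ∑ y_k q_k)` to `(z, z')`, where `z' - ∑ y_k q_k ∈ Λ`. -/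
def poincareLog (l : LieG g s) (y : Fin s → ℤ) (z' : LieA g) : ℂ :=
  ∑ k, (y k : ℂ) * (l.2 k - θ.hDot (M.q k) l.1) -
    Real.pi * A.H l.1 (z' - ∑ k, y k • M.q k)

/-- The Weil pairing `T_H(M) ⊗ T_H(M^*) → T_H(𝔾_m) = 2iπℤ`, for `M' = M^*`: the difference between
the two logarithms of the point `ψ(x, y)` of the Poincaré biextension which come from an element of
`T_H(M)` above `x` and an element of `T_H(M^*)` above `y`. For `n = s = 0` it is the pairing
`(λ, μ) ↦ 2iπ Im H(μ, λ)` of `A`. -/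
def weilPairing (M : OneMotive θ n s) (M' : OneMotive θ s n) (α : M.TH) (β : M'.TH) : ℂ :=
  M.poincareLog α.1.1 β.1.2 β.1.1.1 - M'.poincareLog β.1.1 α.1.2 α.1.1.1

variable {M} in
/-- The ordered bases of `T_H(M)` and `T_H(M^*)` are dual to each other. -/
def Choices.Dual (B : M.Choices) (B' : M'.Choices) : Prop :=
  ∀ a b : Idx n g s, weilPairing M M' (B.basisH a).class' (B'.dualBasisH b).class' =
    if a = b then 2 * Real.pi * Complex.I else 0

/-! ### Period matrices -/

/-- The order-preserving enumeration of `Fin a ⊕ ((Fin b ⊕ Fin b) ⊕ Fin c)`. -/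
def ordered (a b c : ℕ) : Idx a b c ≃ Fin (a + (b + b + c)) :=
  (Equiv.sumCongr (Equiv.refl _)
    ((Equiv.sumCongr finSumFinEquiv (Equiv.refl _)).trans finSumFinEquiv)).trans finSumFinEquiv

/-- The enumeration of `T_H`: `n`, then `2g`, then `s` elements. -/
def rowEquiv (n g s : ℕ) : Idx n g s ≃ Fin (n + 2 * g + s) :=
  (ordered n g s).trans (finCongr (by omega))

/-- The enumeration of `T_dR`: `s`, then `2g`, then `n` elements. -/
def colEquiv (n g s : ℕ) : Idx s g n ≃ Fin (n + 2 * g + s) :=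
  (ordered s g n).trans (finCongr (by omega))

variable {M} in
/-- The period matrix `Π_M`. -/
def Choices.periodMatrix (B : M.Choices) :
    Matrix (Fin (n + 2 * g + s)) (Fin (n + 2 * g + s)) ℂ :=
  Matrix.reindex (rowEquiv n g s) (colEquiv n g s)
    (Matrix.of fun a b => period (B.basisH a) (B.basisDR b))

/-- The period matrix `Π_{M^*}` with respect to the dual bases. -/
def Choices.dualPeriodMatrix (B : M'.Choices) :
    Matrix (Fin (n + 2 * g + s)) (Fin (n + 2 * g + s)) ℂ :=
  Matrix.reindex (rowEquiv n g s) (colEquiv n g s)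
    (Matrix.of fun a b => period (B.dualBasisH a) (B.dualBasisDR b))

end OneMotive

end OneMot

end

/-! The product of `Π_M` with the transpose of `Π_{M^*}` is the matrix of Weil pairings. On `Lie G`,
away from the poles, the basic forms have primitives: `-t_k` for `ξ_{Q_k}`, `z_j` for `ω_j`, `h_j`
for `η_j` and `f_i` for `df_i`. The periods of a basis chain therefore depend only on its class
`((z, t), x)`, as recorded in `HasClassPeriods`; for `η_j` this rests on `h_add_of_mem_lattice`: a
lattice translation changes `h_j` by a constant. With these values, the sum over the forms of
products of periods splits in two. The terms `ξ`, `ω` against `-df^*`, `-η^*` give the logarithm of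
a Poincaré point coming from `M`; the terms `η`, `df` against `ω^*`, `ξ^*` give minus the one coming
from `M^*`. This is `sum_period_mul_period_eq_weilPairing`; for dual bases the product of matrices
is thus `2iπ` times the identity. For the determinant, a permutation of the columns makes `Π_M`
block triangular, with diagonal blocks the identity, the period matrix of `A` and `2iπ` times the
identity. The Legendre relations give `±(2iπ)^g` for the middle block. The determinant of `Π_{M^*}`
then follows from the product formula. -/

open Complex

/-! ### Curve integrals of exact forms, and determinants under reindexing. -/

/-- The fundamental theorem of calculus for curve integrals. -/
theorem curveIntegral_eq_sub_of_eq_fderiv {E : Type*} [NormedAddCommGroup E] [NormedSpace ℂ E]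
    {a b : E} (γ : Path a b) (hγ : ContDiffOn ℝ 1 γ.extend (Set.Icc 0 1)) {f : E → ℂ}
    (hf : ∀ τ, AnalyticAt ℂ f (γ τ)) {ω : E → E →L[ℂ] ℂ}
    (hω : ∀ τ, ω (γ τ) = fderiv ℂ f (γ τ)) : curveIntegral ω γ = f b - f a := by
  have hmem : ∀ t ∈ Set.Icc (0 : ℝ) 1, ∃ τ, γ.extend t = γ τ := fun t ht =>
    ⟨⟨t, ht⟩, γ.extend_apply ht⟩
  have hint : CurveIntegrable ω γ := by
    -- `ω` is only controlled on the image of the path, so continuity is tested within that image,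
    -- where `ω` equals the continuous `fderiv ℂ f`.
    refine ContinuousOn.curveIntegrable_of_contDiffOn (s := Set.range γ) ?_ hγ fun t => ⟨t, rfl⟩
    have : ContinuousOn (fderiv ℂ f) (Set.range γ) := by
      rintro _ ⟨τ, rfl⟩
      exact (hf τ).fderiv.continuousAt.continuousWithinAt
    refine this.congr ?_
    rintro _ ⟨τ, rfl⟩
    exact hω τ
  rw [curveIntegral_def]
  have hcont : ContinuousOn (fun t => f (γ.extend t)) (Set.Icc 0 1) := by
    intro t ht
    obtain ⟨τ, hτ⟩ := hmem t ht
    have h1 : ContinuousAt f (γ.extend t) := hτ ▸ (hf τ).continuousAt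
    exact (h1.comp γ.continuous_extend.continuousAt).continuousWithinAt
  rw [intervalIntegral.integral_eq_sub_of_hasDerivAt_of_le
    (f := fun t => f (γ.extend t)) zero_le_one hcont ?_ hint]
  · simp
  · intro t ht
    obtain ⟨τ, hτ⟩ := hmem t (Set.Ioo_subset_Icc_self ht)
    -- The extended path is constant outside `[0, 1]` and may fail to be differentiable at the
    -- endpoints; at interior points the derivative within `[0, 1]` is the ordinary one.
    have hnhds : Set.Icc (0 : ℝ) 1 ∈ nhds t := Icc_mem_nhds ht.1 ht.2
    have h1 : HasDerivAt γ.extend (derivWithin γ.extend (Set.Icc 0 1) t) t := by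
      rw [derivWithin_of_mem_nhds hnhds]
      exact (((hγ.differentiableOn one_ne_zero) t
        (Set.Ioo_subset_Icc_self ht)).differentiableAt hnhds).hasDerivAt
    have h2 : HasFDerivAt f (ω (γ.extend t)) (γ.extend t) := by
      rw [hτ, hω τ]
      exact (hf τ).differentiableAt.hasFDerivAt
    rw [curveIntegralFun_def]
    exact (h2.restrictScalars ℝ).comp_hasDerivAt t h1

/-- Two identifications of rows with columns differ by a permutation, whose sign is the only
ambiguity. This allows the ordered enumerations to be replaced by a convenient block matching. -/
theorem Matrix.det_submatrix_equiv_eq_or_eq_neg {ι κ μ R : Type*} [Fintype ι] [DecidableEq ι]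
    [Fintype κ] [DecidableEq κ] [CommRing R] (N : Matrix κ μ R) (e : ι ≃ κ) (f : ι ≃ μ)
    (f' : κ ≃ μ) : (N.submatrix e f).det = (N.submatrix id f').det ∨
      (N.submatrix e f).det = -(N.submatrix id f').det := by
  have h : N.submatrix e f = ((N.submatrix id f').submatrix id
      ((e.symm.trans f).trans f'.symm)).submatrix e e := by
    ext i j
    simp
  rw [h, Matrix.det_submatrix_equiv_self, Matrix.det_permute']
  rcases Int.units_eq_one_or (Equiv.Perm.sign ((e.symm.trans f).trans f'.symm)) with h | h <;>
    simp [h]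

namespace OneMot

/-! ### The Hermitian form and the logarithmic derivatives of theta functions. -/

namespace PPAV

variable {g : ℕ} (A : PPAV g)

theorem H_eq_sum (z w : LieA g) : A.H z w = ∑ j, z j * A.H (Pi.single j 1) w := by
  conv_lhs => rw [pi_eq_sum_univ' z]
  simp only [map_sum, LinearMap.sum_apply, map_smul, LinearMap.smul_apply, smul_eq_mul]

theorem H_sub_H_symm (z w : LieA g) : A.H w z - A.H z w = 2 * I * (A.H w z).im := by
  rw [A.hermitian w z]
  apply Complex.ext <;> simp
  ring

end PPAV

namespace Theta

variable {g : ℕ} {A : PPAV g} (θ : Theta A)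

theorem differentiableAt (z : LieA g) : DifferentiableAt ℂ θ z :=
  (θ.holomorphic z trivial).differentiableAt

theorem h_zero (j : Fin g) : θ.h j 0 = 0 := by
  simp [h, θ.fderiv_zero]

theorem analyticAt_h (j : Fin g) {z : LieA g} (hz : θ z ≠ 0) : AnalyticAt ℂ (θ.h j) z := by
  have h1 : AnalyticAt ℂ (fun w => fderiv ℂ θ w (Pi.single j 1)) z :=
    (ContinuousLinearMap.analyticAt (ContinuousLinearMap.apply ℂ ℂ (Pi.single j (1 : ℂ) : LieA g))
      _).comp (θ.holomorphic z trivial).fderiv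
  exact h1.div (θ.holomorphic z trivial) hz

/-- Logarithmic differentiation of the quasi-periodicity: the exponent `π H(z, l)` is linear in `z`,
and its derivative along the `j`-th basis vector is the additive constant. -/
theorem h_add_of_mem_lattice (j : Fin g) {z l : LieA g} (hl : l ∈ A.lattice)
    (hz : θ (z + l) ≠ 0) : θ.h j (z + l) = θ.h j z + Real.pi * A.H (Pi.single j 1) l := by
  obtain ⟨c, hc⟩ := θ.quasi_periodic l hl
  have hz' := hz
  rw [hc] at hz'
  -- Nonvanishing at `z + l` alone forces both `c ≠ 0` and `θ z ≠ 0`.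
  obtain ⟨hcz, hz0⟩ := mul_ne_zero_iff.1 hz'
  obtain ⟨hc0, he0⟩ := mul_ne_zero_iff.1 hcz
  let L : LieA g →L[ℂ] ℂ := (A.H.flip l).toContinuousLinearMap
  have hL : ∀ w, L w = A.H w l := fun w => rfl
  have h1 : HasFDerivAt (fun w => c * exp (Real.pi * L w) * θ w)
      ((c * exp (Real.pi * L z)) • fderiv ℂ θ z +
        θ z • (c • (exp (Real.pi * L z) • ((Real.pi : ℂ) • L)))) z :=
    (((L.hasFDerivAt.const_mul (Real.pi : ℂ)).cexp).const_mul c).mul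
      (θ.differentiableAt z).hasFDerivAt
  have h2 : fderiv ℂ θ (z + l) = (c * exp (Real.pi * L z)) • fderiv ℂ θ z +
        θ z • (c • (exp (Real.pi * L z) • ((Real.pi : ℂ) • L))) := by
    rw [← h1.fderiv, ← fderiv_comp_add_right]
    congr 1
    funext w
    exact hc w
  simp only [h]
  rw [h2, hc]
  simp only [add_apply, smul_apply, smul_eq_mul, hL]
  field_simp

theorem F_analyticAt {q z : LieA g} (hq : θ q ≠ 0) (hz : θ z ≠ 0) :
    AnalyticAt ℂ (θ.F q) z := by
  have ha : AnalyticAt ℂ (fun w : LieA g => w + q) z := analyticAt_id.add analyticAt_const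
  have h1 : AnalyticAt ℂ (fun w => θ (w + q)) z :=
    AnalyticAt.comp (g := θ) (θ.holomorphic (z + q) trivial) ha
  have h2 : AnalyticAt ℂ (fun w => θ w * θ q) z :=
    (θ.holomorphic z trivial).mul analyticAt_const
  have h3 : AnalyticAt ℂ (fun w => θ.hDot q w) z := by
    unfold hDot
    refine Finset.analyticAt_fun_sum _ fun j _ => analyticAt_const.mul ?_
    exact (ContinuousLinearMap.proj (R := ℂ) (φ := fun _ : Fin g => ℂ) j).analyticAt z
  exact (h1.div h2 (mul_ne_zero hz hq)).mul h3.neg.cexp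

theorem F_ne_zero {q z : LieA g} (hq : θ q ≠ 0) (hz : θ z ≠ 0) (hzq : θ (z + q) ≠ 0) :
    θ.F q z ≠ 0 :=
  mul_ne_zero (div_ne_zero hzq (mul_ne_zero hz hq)) (exp_ne_zero _)

end Theta

/-! ### Periods of the individual forms. -/

namespace OneMotive

variable {g n s : ℕ} {A : PPAV g} {θ : Theta A} {M : OneMotive θ n s}

/-- Since `Z_k = exp(t_k) F_{q_k}(z)`, one has `dZ_k / Z_k = dt_k + d log F_{q_k}`; the last term
cancels against `π^* ξ_{Q_k}` and leaves `-dt_k`. -/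
theorem xi_form_eq (k : Fin s) {l : LieG g s} (hl : θ l.1 ≠ 0) (hlq : θ (l.1 + M.q k) ≠ 0) :
    (M.xi k).form l =
      -((ContinuousLinearMap.proj k).comp (ContinuousLinearMap.snd ℂ (LieA g) (Fin s → ℂ))) := by
  have hF := θ.F_ne_zero (M.theta_q k) hl hlq
  have h1 := (θ.F_analyticAt (M.theta_q k) hl).differentiableAt.hasFDerivAt
  have h2 : HasFDerivAt (fun l : LieG g s => θ.F (M.q k) l.1)
      ((fderiv ℂ (θ.F (M.q k)) l.1).comp (ContinuousLinearMap.fst ℂ (LieA g) (Fin s → ℂ))) l :=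
    h1.comp l (ContinuousLinearMap.fst ℂ (LieA g) (Fin s → ℂ)).hasFDerivAt
  have h3 : HasFDerivAt (fun l : LieG g s => Complex.exp (l.2 k)) (Complex.exp (l.2 k) •
      ((ContinuousLinearMap.proj k).comp (ContinuousLinearMap.snd ℂ (LieA g) (Fin s → ℂ)))) l :=
    ((ContinuousLinearMap.proj (R := ℂ) (φ := fun _ : Fin s => ℂ) k).comp
      (ContinuousLinearMap.snd ℂ (LieA g) (Fin s → ℂ))).hasFDerivAt.cexp
  have h4 : fderiv ℂ (coordZ θ M.q k) l = _ := (h3.mul h2).fderiv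
  have he := exp_ne_zero (l.2 k)
  ext v
  all_goals
    simp only [xi, h4, coordZ]
    simp
    field_simp
    try ring

theorem period_xi {c : M.Chain} (hc : c.Regular) (k : Fin s) :
    period c (M.xi k) = -(c.tgt - c.src).2 k := by
  have := curveIntegral_eq_sub_of_eq_fderiv c.path hc.contDiffOn (ω := (M.xi k).form)
    (f := (-((ContinuousLinearMap.proj k).comp
      (ContinuousLinearMap.snd ℂ (LieA g) (Fin s → ℂ))) : LieG g s →L[ℂ] ℂ))
    (fun τ => ContinuousLinearMap.analyticAt _ _) fun τ => by
      rw [ContinuousLinearMap.fderiv]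
      exact xi_form_eq k (hc.theta_ne τ) (hc.theta_add_ne τ k)
  rw [period, this]
  simp [xi]
  ring

theorem period_omega {c : M.Chain} (hc : c.Regular) (j : Fin g) :
    period c (M.omega j) = (c.tgt - c.src).1 j := by
  have := curveIntegral_eq_sub_of_eq_fderiv c.path hc.contDiffOn (ω := (M.omega j).form)
    (f := (ContinuousLinearMap.proj j).comp (ContinuousLinearMap.fst ℂ (LieA g) (Fin s → ℂ)))
    (fun τ => ContinuousLinearMap.analyticAt _ _) fun τ => by
      rw [ContinuousLinearMap.fderiv]
      rfl
  rw [period, this]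
  simp [omega]

theorem period_eta {c : M.Chain} (hc : c.Regular) (j : Fin g) :
    period c (M.eta j) = θ.h j c.tgt.1 - θ.h j c.src.1 := by
  have ha : ∀ τ, AnalyticAt ℂ (fun l : LieG g s => θ.h j l.1) (c.path τ) := fun τ =>
    AnalyticAt.comp (g := θ.h j) (f := Prod.fst) (θ.analyticAt_h j (hc.theta_ne τ)) analyticAt_fst
  have := curveIntegral_eq_sub_of_eq_fderiv c.path hc.contDiffOn (ω := (M.eta j).form) ha
    fun τ => by
      have h1 := (θ.analyticAt_h j (hc.theta_ne τ)).differentiableAt.hasFDerivAt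
      exact (HasFDerivAt.fderiv (h1.comp (c.path τ)
        (ContinuousLinearMap.fst ℂ (LieA g) (Fin s → ℂ)).hasFDerivAt)).symm
  rw [period, this]
  simp [eta]

theorem period_exact {c : M.Chain} (hc : c.Regular) {f : LieG g s → ℂ}
    (hf : ∀ τ, AnalyticAt ℂ f (c.path τ)) (a : Fin n → ℂ) :
    period c (M.exact f a) = f c.tgt - f c.src + ∑ i, a i * c.x i := by
  have := curveIntegral_eq_sub_of_eq_fderiv c.path hc.contDiffOn hf
    (ω := (M.exact f a).form) fun τ => rfl
  rw [period, this]
  rfl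

theorem period_neg_chain (c : M.Chain) (w : M.Form) : period c.neg w = -period c w := by
  simp [period, Chain.neg, add_comm]

theorem period_neg_form (c : M.Chain) (w : M.Form) : period c w.neg = -period c w := by
  have : curveIntegral w.neg.form c.path = -curveIntegral w.form c.path := curveIntegral_neg
  rw [period, this]
  simp [period, Form.neg, add_comm]

/-! ### Periods in terms of classes in the Hodge realisation. -/

theorem projA_exp (l : LieG g s) : projA θ M.q (M.exp l) = (l.1 : A.Torus) := rfl

/-- Both vectors are logarithms of the same point `P_i`: one through `R_i`, the other as parameter
of `G^*`. -/
theorem Chain.boundary_mem_lattice {M' : OneMotive θ s n} (hP : ∀ i, M.P i = M'.Q i)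
    (c : M.Chain) {i : Fin n} (hx : c.x = Pi.single i 1) :
    (c.tgt - c.src).1 - M'.q i ∈ A.lattice := by
  have h1 := hP i
  rw [P, R, ← hx, ← c.boundary, projA_exp, Q, eq_comm, QuotientAddGroup.eq] at h1
  rwa [sub_eq_neg_add]

theorem Chain.boundary_mem_kerExp (c : M.Chain) (hx : c.x = 0) :
    c.tgt - c.src ∈ kerExp θ M.q := by
  have h := c.boundary
  rw [hx, map_zero] at h
  exact (QuotientAddGroup.eq_zero_iff _).1 h

/-- The chain has the periods expected from its class in `T_H(M)`. -/
structure Choices.HasClassPeriods (B : M.Choices) (M' : OneMotive θ s n) (c : M.Chain) : Prop where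
  xi : ∀ k, period c (M.xi k) = -(c.tgt - c.src).2 k
  omega : ∀ j, period c (M.omega j) = (c.tgt - c.src).1 j
  eta : ∀ j, period c (M.eta j) = ∑ i, c.x i * θ.h j (M'.q i) +
    Real.pi * A.H (Pi.single j 1) ((c.tgt - c.src).1 - ∑ i, c.x i • M'.q i)
  exact : ∀ i, period c (M.exact (B.f i) (B.a i)) = c.x i

/-- All four expressions are additive in the class, so the property passes to the opposite chains in
the dual basis. -/
theorem Choices.HasClassPeriods.neg {B : M.Choices} {M' : OneMotive θ s n} {c : M.Chain}
    (h : B.HasClassPeriods M' c) : B.HasClassPeriods M' c.neg where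
  xi k := by rw [period_neg_chain, h.xi]; simp [Chain.neg]
  omega j := by rw [period_neg_chain, h.omega]; simp [Chain.neg]
  eta j := by
    rw [period_neg_chain, h.eta]
    simp only [Chain.neg, Pi.neg_apply, neg_smul, Finset.sum_neg_distrib, Int.cast_neg, neg_mul,
      Prod.fst_sub, map_sub, map_neg]
    ring
  exact i := by rw [period_neg_chain, h.exact]; simp [Chain.neg]

/-- The path starts at `0`, where `h_j` vanishes by the normalisation of `θ`, so the period of `η_j`
is `h_j` at the endpoint. That endpoint differs from `M'.q i` by a lattice vector. -/
theorem Choices.hasClassPeriods_pathR (B : M.Choices) {M' : OneMotive θ s n}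
    (hP : ∀ i, M.P i = M'.Q i) (i : Fin n) : B.HasClassPeriods M' (B.pathR i) where
  xi := period_xi (B.regularR i)
  omega := period_omega (B.regularR i)
  eta j := by
    have hl := (B.pathR i).boundary_mem_lattice hP (B.xR i)
    have hθ := (B.regularR i).theta_ne 1
    rw [period_eta (B.regularR i), B.srcR, B.xR]
    rw [B.srcR, sub_zero] at hl
    simp only [Path.target] at hθ
    have := θ.h_add_of_mem_lattice j (z := M'.q i) hl (by simpa using hθ)
    rw [add_sub_cancel] at this
    simp [this, θ.h_zero, Pi.single_apply]
  exact j := by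
    rw [period_exact (B.regularR i) (B.analyticR j i), B.srcR, B.xR]
    have := B.value j i
    simp only [Pi.single_apply, Int.cast_ite, Int.cast_one, Int.cast_zero, mul_ite, mul_one,
      mul_zero, Finset.sum_ite_eq', Finset.mem_univ, if_true]
    exact this

/-- The endpoints differ by an element of `kerExp`: the values of `h_j` differ by the quasi-period,
and those of the periodic `f_i` agree. -/
theorem Choices.hasClassPeriods_of_x_eq_zero (B : M.Choices) (M' : OneMotive θ s n) {c : M.Chain}
    (hc : c.Regular) (hx : c.x = 0) (hf : ∀ i τ, AnalyticAt ℂ (B.f i) (c.path τ)) :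
    B.HasClassPeriods M' c where
  xi := period_xi hc
  omega := period_omega hc
  eta j := by
    have hl := (c.boundary_mem_kerExp hx).1
    have hθ := hc.theta_ne 1
    simp only [Path.target] at hθ
    have := θ.h_add_of_mem_lattice j (z := c.src.1) hl (by simpa using hθ)
    rw [Prod.fst_sub, add_sub_cancel] at this
    rw [period_eta hc, this, hx]
    simp
  exact j := by
    have := B.periodic j _ (c.boundary_mem_kerExp hx) c.src
    rw [add_sub_cancel] at this
    rw [period_exact hc (hf j), hx, this]
    simp

/-- Contracting the `η`-periods with the `ω`-periods `z` of a dual chain produces the `hDot` and `H`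
terms of `poincareLog`. -/
theorem Choices.HasClassPeriods.sum_period_eta {B : M.Choices} {M' : OneMotive θ s n}
    {c : M.Chain} (h : B.HasClassPeriods M' c) (z : LieA g) :
    ∑ j, period c (M.eta j) * z j = ∑ i, (c.x i : ℂ) * θ.hDot (M'.q i) z +
      Real.pi * A.H z ((c.tgt - c.src).1 - ∑ i, c.x i • M'.q i) := by
  rw [A.H_eq_sum z]
  simp only [h.eta, Theta.hDot, add_mul, Finset.mul_sum, Finset.sum_mul, Finset.sum_add_distrib]
  rw [Finset.sum_comm]
  congr 1
  · exact Finset.sum_congr rfl fun _ _ => Finset.sum_congr rfl fun _ _ => by ring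
  · exact Finset.sum_congr rfl fun _ _ => by ring

/-- The period pairing of the classes of two chains is their Weil pairing. -/
theorem sum_period_mul_period_eq_weilPairing {M' : OneMotive θ s n} {B : M.Choices}
    {B' : M'.Choices} {c : M.Chain} {c' : M'.Chain} (hc : B.HasClassPeriods M' c)
    (hc' : B'.HasClassPeriods M c') :
    ∑ b, period c (B.basisDR b) * period c' (B'.dualBasisDR b) =
      weilPairing M M' c.class' c'.class' := by
  -- `e1` supplies these terms for the logarithm on the side of `M'`, and `e2` for the one on the
  -- side of `M`.
  have e1 := hc.sum_period_eta (c'.tgt - c'.src).1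
  have e2 := hc'.sum_period_eta (c.tgt - c.src).1
  simp only [Fintype.sum_sum_type, Choices.basisDR, Choices.dualBasisDR, period_neg_form,
    mul_neg, Finset.sum_neg_distrib, weilPairing, poincareLog, Chain.class', hc.xi, hc'.xi,
    hc.omega, hc'.omega, hc.exact, hc'.exact, e1, neg_mul, neg_neg, mul_sub,
    Finset.sum_sub_distrib]
  simp only [mul_comm ((c.tgt - c.src).1 _), e2]
  simp only [mul_comm ((c.tgt - c.src).2 _)]
  ring

theorem Choices.hasClassPeriods_basisH (B : M.Choices) {M' : OneMotive θ s n}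
    (hP : ∀ i, M.P i = M'.Q i) (a : Idx n g s) : B.HasClassPeriods M' (B.basisH a) := by
  rcases a with i | a | k
  · exact B.hasClassPeriods_pathR hP i
  · exact B.hasClassPeriods_of_x_eq_zero M' (B.regularγ a) (B.xγ a) fun i => B.analyticγ i a
  · exact B.hasClassPeriods_of_x_eq_zero M' (B.regularδ k) (B.xδ k) fun i => B.analyticδ i k

theorem Choices.hasClassPeriods_dualBasisH {M' : OneMotive θ s n} (B' : M'.Choices)
    (hP : ∀ k, M'.P k = M.Q k) (a : Idx n g s) : B'.HasClassPeriods M (B'.dualBasisH a) := by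
  rcases a with i | (j | j) | k
  · exact B'.hasClassPeriods_basisH hP (.inr (.inr i))
  · exact (B'.hasClassPeriods_basisH hP (.inr (.inl (.inr j)))).neg
  · exact B'.hasClassPeriods_basisH hP (.inr (.inl (.inl j)))
  · exact (B'.hasClassPeriods_basisH hP (.inl k)).neg

theorem periodMatrix_mul_dualPeriodMatrix_transpose {M' : OneMotive θ s n}
    (hM : M.IsCartierDual M') (B : M.Choices) (B' : M'.Choices) (hB : B.Dual B') :
    B.periodMatrix * B'.dualPeriodMatrix.transpose = (2 * Real.pi * I : ℂ) • 1 := by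
  ext a b
  obtain ⟨a, rfl⟩ := (rowEquiv n g s).surjective a
  obtain ⟨b, rfl⟩ := (rowEquiv n g s).surjective b
  rw [Matrix.mul_apply, ← (colEquiv n g s).sum_comp]
  simp only [Choices.periodMatrix, Choices.dualPeriodMatrix, Matrix.transpose_apply,
    Matrix.reindex_apply, Matrix.submatrix_apply, Equiv.symm_apply_apply, Matrix.of_apply]
  rw [sum_period_mul_period_eq_weilPairing (B.hasClassPeriods_basisH hM.1 a)
    (B'.hasClassPeriods_dualBasisH hM.2.1 b), hB a b]
  simp [Matrix.one_apply]

end OneMotive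

/-! ### Legendre relations and the period determinant of `A`. -/

namespace PPAV

variable {g : ℕ} (A : PPAV g)

/-- The periods of `ω_1, …, ω_g, η_1, …, η_g` along the loops `λ_a`. -/
noncomputable def periodMatrix : Matrix (Fin g ⊕ Fin g) (Fin g ⊕ Fin g) ℂ :=
  Matrix.of fun a => Sum.elim (A.lam a) fun j => Real.pi * A.H (Pi.single j 1) (A.lam a)

/-- The Legendre relations. -/
theorem periodMatrix_mul_J_mul_transpose :
    A.periodMatrix * Matrix.J (Fin g) ℂ * A.periodMatrix.transpose =
      (2 * Real.pi * I : ℂ) • Matrix.J (Fin g) ℂ := by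
  ext a b
  have h1 : (A.periodMatrix * Matrix.J (Fin g) ℂ * A.periodMatrix.transpose) a b =
      Real.pi * (A.H (A.lam b) (A.lam a) - A.H (A.lam a) (A.lam b)) := by
    rw [A.H_eq_sum (A.lam b), A.H_eq_sum (A.lam a), mul_sub, Finset.mul_sum, Finset.mul_sum]
    simp only [Matrix.mul_apply, Fintype.sum_sum_type, Matrix.transpose_apply, periodMatrix,
      Matrix.of_apply, Sum.elim_inl, Sum.elim_inr, Matrix.J, Matrix.fromBlocks_apply₁₁,
      Matrix.fromBlocks_apply₁₂, Matrix.fromBlocks_apply₂₁, Matrix.fromBlocks_apply₂₂,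
      Matrix.zero_apply, Matrix.neg_apply, Matrix.one_apply, mul_zero, mul_neg, mul_ite, mul_one,
      Finset.sum_neg_distrib, Finset.sum_ite_eq', Finset.mem_univ, if_true,
      Finset.sum_const_zero, zero_add, add_zero, neg_mul]
    rw [← Finset.sum_neg_distrib, ← Finset.sum_add_distrib, ← Finset.sum_sub_distrib]
    exact Finset.sum_congr rfl fun _ _ => by ring
  rw [h1, A.H_sub_H_symm, A.symplectic]
  -- `Matrix.J` has the opposite sign to `stdJ`, which absorbs the exchange of `a` and `b`.
  have h2 : ((stdJ g b a : ℝ) : ℂ) = Matrix.J (Fin g) ℂ a b := by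
    rcases a with a | a <;> rcases b with b | b <;>
      simp [stdJ, Matrix.J, Matrix.one_apply, eq_comm]
    all_goals split_ifs <;> simp
  rw [h2]
  simp
  ring

/-- Determinants of the Legendre relations give the square `(2iπ)^{2g}`, since `det J` can be
cancelled; the sign remains undetermined. -/
theorem det_periodMatrix : A.periodMatrix.det = (2 * Real.pi * I : ℂ) ^ g ∨
    A.periodMatrix.det = -(2 * Real.pi * I : ℂ) ^ g := by
  have h := congrArg Matrix.det A.periodMatrix_mul_J_mul_transpose
  have hJ := (Matrix.isUnit_det_J (Fin g) ℂ).ne_zero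
  rw [Matrix.det_mul, Matrix.det_mul, Matrix.det_transpose, Matrix.det_smul, Fintype.card_sum,
    Fintype.card_fin] at h
  apply sq_eq_sq_iff_eq_or_eq_neg.1
  apply mul_right_cancel₀ hJ
  rw [← pow_mul, mul_two, ← h]
  ring

end PPAV

/-! ### Determinant of the period matrix of a 1-motive. -/

namespace OneMotive

variable {g n s : ℕ} {A : PPAV g} {θ : Theta A} {M : OneMotive θ n s}

/-- The permutation of blocks under which period matrices become block triangular. -/
def swapIdx (n g s : ℕ) : Idx n g s ≃ Idx s g n where
  toFun := Sum.elim (fun i => .inr (.inr i))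
    (Sum.elim (fun a => .inr (.inl a)) fun k => .inl k)
  invFun := Sum.elim (fun i => .inr (.inr i))
    (Sum.elim (fun a => .inr (.inl a)) fun k => .inl k)
  left_inv := by rintro (_ | _ | _) <;> rfl
  right_inv := by rintro (_ | _ | _) <;> rfl

/-- With the columns ordered `df`, then `ω` and `η`, then `ξ`, the blocks below the diagonal vanish:
exact classes have no periods on loops, and forms pulled back from `A` have none on loops in the
torus. -/
theorem det_period_submatrix_swapIdx {M' : OneMotive θ s n} (hP : ∀ i, M.P i = M'.Q i)
    (B : M.Choices) :
    ((Matrix.of fun a b => period (B.basisH a) (B.basisDR b)).submatrix id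
      (swapIdx n g s)).det = A.periodMatrix.det * (2 * Real.pi * I : ℂ) ^ s := by
  set N := (Matrix.of fun a b => period (B.basisH a) (B.basisDR b)).submatrix id (swapIdx n g s)
  have h11 : N.toBlocks₁₁ = 1 := by
    ext i j
    refine ((B.hasClassPeriods_basisH hP (.inl i)).exact j).trans ?_
    simp [Choices.basisH, B.xR, Pi.single_apply, Matrix.one_apply, eq_comm]
  have h21 : N.toBlocks₂₁ = 0 := by
    ext a j
    refine ((B.hasClassPeriods_basisH hP (.inr a)).exact j).trans ?_
    rcases a with a | k <;> simp [Choices.basisH, B.xγ, B.xδ]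
  have h22 : N.toBlocks₂₂.toBlocks₁₁ = A.periodMatrix := by
    ext a j
    have h := B.hasClassPeriods_basisH hP (.inr (.inl a))
    rcases j with j | j
    · refine (h.omega j).trans ?_
      rw [Prod.fst_sub]
      exact congrFun (B.liftγ a) j
    · refine (h.eta j).trans ?_
      simp [Choices.basisH, B.xγ, B.liftγ, PPAV.periodMatrix]
  have hδ : ∀ k, ((B.loopδ k).tgt - (B.loopδ k).src).1 = 0 := fun k => by
    have h0 := B.torusδ k 0
    have h1 := B.torusδ k 1
    simp only [Path.source, Path.target] at h0 h1
    simp [h0, h1]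
  have h32 : N.toBlocks₂₂.toBlocks₂₁ = 0 := by
    ext k j
    have h := B.hasClassPeriods_basisH hP (.inr (.inr k))
    rcases j with j | j
    · refine (h.omega j).trans ?_
      exact congrFun (hδ k) j
    · refine (h.eta j).trans ?_
      simp only [Choices.basisH, B.xδ, hδ]
      simp
  have h33 : N.toBlocks₂₂.toBlocks₂₂ = (2 * Real.pi * I : ℂ) • 1 := by
    ext k l
    change curveIntegral _ _ + ∑ i, (0 : ℂ) * _ = _
    refine (congrArg (· + _) (B.normδ k l)).trans ?_
    simp [Matrix.one_apply]
  rw [← Matrix.fromBlocks_toBlocks N, h21, Matrix.det_fromBlocks_zero₂₁, h11,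
    ← Matrix.fromBlocks_toBlocks N.toBlocks₂₂, h32, Matrix.det_fromBlocks_zero₂₁, h22, h33]
  simp

theorem det_periodMatrix {M' : OneMotive θ s n} (hP : ∀ i, M.P i = M'.Q i) (B : M.Choices) :
    B.periodMatrix.det = (2 * Real.pi * I : ℂ) ^ (g + s) ∨
      B.periodMatrix.det = -(2 * Real.pi * I : ℂ) ^ (g + s) := by
  have h := Matrix.det_submatrix_equiv_eq_or_eq_neg
    (Matrix.of fun a b => period (B.basisH a) (B.basisDR b)) (rowEquiv n g s).symm
    (colEquiv n g s).symm (swapIdx n g s)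
  rw [det_period_submatrix_swapIdx hP B] at h
  rw [Choices.periodMatrix, Matrix.reindex_apply, pow_add]
  rcases h with h | h <;> rcases A.det_periodMatrix with h' | h' <;> rw [h, h'] <;> simp

end OneMotive
end OneMot

theorem mainTheorem5 {g n s : ℕ} {A : OneMot.PPAV g} {θ : OneMot.Theta A}
    (M : OneMot.OneMotive θ n s) (M' : OneMot.OneMotive θ s n) (hM : M.IsCartierDual M')
    (B : M.Choices) (B' : M'.Choices) (hB : B.Dual B') :
    B'.dualPeriodMatrix = ((2 * Real.pi * Complex.I : ℂ) • B.periodMatrix⁻¹).transpose ∧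
    (B.periodMatrix.det = (2 * Real.pi * Complex.I : ℂ) ^ (g + s) ∨
      B.periodMatrix.det = -(2 * Real.pi * Complex.I : ℂ) ^ (g + s)) ∧
    (B'.dualPeriodMatrix.det = (2 * Real.pi * Complex.I : ℂ) ^ (n + g) ∨
      B'.dualPeriodMatrix.det = -(2 * Real.pi * Complex.I : ℂ) ^ (n + g)) := by
  have hmul := OneMot.OneMotive.periodMatrix_mul_dualPeriodMatrix_transpose hM B B' hB
  have hdet := OneMot.OneMotive.det_periodMatrix hM.1 B
  have hpi : (2 * Real.pi * Complex.I : ℂ) ≠ 0 := Complex.two_pi_I_ne_zero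
  refine ⟨?_, hdet, ?_⟩
  · have hunit : IsUnit B.periodMatrix.det := by
      refine isUnit_iff_ne_zero.2 ?_
      rcases hdet with h | h <;> rw [h]
      · exact pow_ne_zero _ hpi
      · exact neg_ne_zero.2 (pow_ne_zero _ hpi)
    have h := congrArg (B.periodMatrix⁻¹ * ·) hmul
    simp only [Matrix.nonsing_inv_mul_cancel_left _ _ hunit, mul_smul_comm, mul_one] at h
    rw [← h, Matrix.transpose_transpose]
  -- The determinant of the scalar matrix is `(2iπ)^{n+2g+s}`; cancelling `±(2iπ)^{g+s}` leaves
  -- `±(2iπ)^{n+g}`.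
  · have h := congrArg Matrix.det hmul
    have hexp : n + 2 * g + s = (g + s) + (n + g) := by ring
    rw [Matrix.det_mul, Matrix.det_transpose, Matrix.det_smul, Matrix.det_one, mul_one,
      Fintype.card_fin, congrArg ((2 * Real.pi * Complex.I : ℂ) ^ ·) hexp, pow_add] at h
    have hne := pow_ne_zero (g + s) hpi
    rcases hdet with h' | h' <;> rw [h'] at h
    · exact .inl (mul_left_cancel₀ hne h)
    · refine .inr (mul_left_cancel₀ hne ?_)
      rw [mul_neg, ← h]
      ring
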